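/- Let $\mathcal{C}\subset\mathbb{R}^p$ be a convex set containing the origin in its interior, let $\|X\|_{\mathcal{C}}=\inf\{s>0: X\in s\,\mathcal{C}\}$ be its Minkowski functional and $\partial\|X\|_{\mathcal{C}}$ the subdifferential of this function at $X$. Let $Y[t]=X^\star[t]+\varepsilon[t]\in\mathbb{R}^p$, $t=1,\dots,n$, where $X^\star[1],\dots,X^\star[n]\in\mathbb{R}^p$ are fixed and the $\varepsilon[t]\sim\mathcal{N}(0,\sigma^2 I_{p\times p})$ are independent, with $\sigma>0$. Put $$\tau^\star=\{1\le t\le n-1: X^\star[t]\ne X^\star[t+1]\},\qquad \Delta_{\min}=\min_{t\in\tau^\star}\|X^\star[t]-X^\star[t+1]\|_2,\qquad T_{\min}=\min_{s,t\in\tau^\star,\ s\ne t}|s-t|,$$ where $\Delta_{\min}$ (if $\tau^\star=\emptyset$) and $T_{\min}$ (if $|\tau^\star|\le 1$) may be any real numbers for which the conditions below hold. For $\tilde\lambda\ge 0$ let $$F(\tilde\lambda)=\max_{1\le t\le n}\mathbb{E}_{g\sim\mathcal{N}(0,I_{p\times p})}\bigl[\mathrm{dist}(g,\tilde\lambda\cdot\partial\|X^\star[t]\|_{\mathcal{C}})\bigr],\qquad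 \eta=\inf_{\tilde\lambda\ge0}F(\tilde\lambda).$$ Suppose that for some $r>1$ $$\Delta_{\min}^2T_{\min}\ge 64\sigma^2\bigl\{\eta+r\sqrt{2\log n}\bigr\}^2,$$ that $T_{\min}/4\le t\le n-T_{\min}/4$ for all $t\in\tau^\star$, and that the integer $\theta\ge1$ and the reals $\gamma,\lambda$ satisfy 1. $T_{\min}/4\ge\theta$, 2. $\Delta_{\min}/2\ge\gamma\ge 2\frac{\sigma}{\sqrt\theta}\{\eta+r\sqrt{2\log n}\}$, 3. $\lambda=\frac{\sigma}{\sqrt\theta}\lambda_0$, where $\lambda_0$ is a minimizer of $F$ over $[0,\infty)$. Let $\bar Y[t]=\frac1\theta\sum_{i=t}^{t+\theta-1}Y[i]$ and $\hat X[t]=\operatorname{argmin}_{X\in\mathbb{R}^p}\frac12\|\bar Y[t]-X\|_2^2+\lambda\|X\|_{\mathcal{C}}$ for $1\le t\le n-\theta+1$, and $S[t]=\|\hat X[t+1]-\hat X[t-\theta+1]\|_2$ for $\theta\le t\le n-\theta$. Let $$\tau_{\mathrm{far}}=\{i:\theta\le i\le n-\theta,\ |i-j|>\theta\text{ for all }j\in\tau^\star\},$$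 $$\tau_{\mathrm{buffer}}=\Bigl\{(t,\delta): t\in\tau^\star,\ \delta\in\mathbb{Z},\ \theta\ge|\delta|>\bigl(4r\sqrt{\log n}+4\eta\bigr)\tfrac{\sigma}{\Delta_{\min}}\sqrt\theta,\ \theta\le t+\delta\le n-\theta\Bigr\},$$ and define the events $$E_1=\{S[t]\ge\gamma\ \ \forall t\in\tau^\star\},\quad E_2=\{S[t]<\gamma\ \ \forall t\in\tau_{\mathrm{far}}\},\quad E_3=\{S[t]>S[t+\delta]\ \ \forall(t,\delta)\in\tau_{\mathrm{buffer}}\}.$$ Then $$\mathbb{P}(E_1^c)\le 2n^{1-r^2},\qquad \mathbb{P}(E_2^c)\le 2n^{1-r^2},\qquad \mathbb{P}(E_3^c)\le n^{1-r^2}.$$ -/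

import Mathlib

open MeasureTheory ProbabilityTheory
open scoped Pointwise

noncomputable section

namespace ChangePoint

/-- The signal space `ℝ^p` with the Euclidean norm. -/
abbrev Vec (p : ℕ) : Type := EuclideanSpace ℝ (Fin p)

/-- The convex subdifferential of `f` at `x`. -/
def subdifferential {p : ℕ} (f : Vec p → ℝ) (x : Vec p) : Set (Vec p) :=
  {v | ∀ y, f x + inner ℝ v (y - x) ≤ f y}

/-- `E_{g ∼ N(0, I)} dist(g, lam · ∂‖x‖_C)`, where `‖·‖_C` is the Minkowski functional of `C`. -/
def gaussDist {p : ℕ} (C : Set (Vec p)) (lam : ℝ) (x : Vec p) : ℝ :=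
  ∫ g, Metric.infDist g (lam • subdifferential (gauge C) x) ∂(stdGaussian (Vec p))

/-- `max_{1 ≤ t ≤ n} E_{g ∼ N(0, I)} dist(g, lam · ∂‖X[t]‖_C)`. -/
def maxGaussDist {p : ℕ} (C : Set (Vec p)) (n : ℕ) (X : ℤ → Vec p) (lam : ℝ) : ℝ :=
  ⨆ t : Set.Icc (1 : ℤ) n, gaussDist C lam (X t)

/-- The Gaussian distance `η_C` of the collection `{X[1], …, X[n]}`. -/
def eta {p : ℕ} (C : Set (Vec p)) (n : ℕ) (X : ℤ → Vec p) : ℝ :=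
  ⨅ lam : Set.Ici (0 : ℝ), maxGaussDist C n X lam

/-- The set of change-points of `X[1], …, X[n]`. -/
def changePoints {p : ℕ} (n : ℕ) (X : ℤ → Vec p) : Set ℤ :=
  {t | 1 ≤ t ∧ t + 1 ≤ n ∧ X t ≠ X (t + 1)}

/-- The sizes of the changes. -/
def jumpSizes {p : ℕ} (n : ℕ) (X : ℤ → Vec p) : Set ℝ :=
  {d | ∃ t ∈ changePoints n X, d = ‖X t - X (t + 1)‖}

/-- The distances between distinct change-points. -/
def spacings {p : ℕ} (n : ℕ) (X : ℤ → Vec p) : Set ℝ :=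
  {d | ∃ s ∈ changePoints n X, ∃ t ∈ changePoints n X, s ≠ t ∧ d = |(s : ℝ) - (t : ℝ)|}

/-- `m` is the minimum of `s`; no condition is put on `m` if there is nothing to minimize over. -/
def IsMinimum (s : Set ℝ) (m : ℝ) : Prop := s.Nonempty → IsLeast s m

/-- The proximal operator: a minimizer of `½‖y - x‖² + lam ‖x‖_C` over `x`. -/
def prox {p : ℕ} (C : Set (Vec p)) (lam : ℝ) (y : Vec p) : Vec p :=
  Classical.epsilon fun x : Vec p =>
    IsMinOn (fun z : Vec p => 1 / 2 * ‖y - z‖ ^ 2 + lam * gauge C z) Set.univ x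

/-- Filtering: the mean of `Y[i], …, Y[i + θ - 1]`. -/
def sampleMean {p : ℕ} (θ : ℕ) (Y : ℤ → Vec p) (i : ℤ) : Vec p :=
  (θ : ℝ)⁻¹ • ∑ t ∈ Finset.Icc i (i + θ - 1), Y t

/-- Denoising: the proximal operator applied to the sample means. -/
def denoised {p : ℕ} (C : Set (Vec p)) (lam : ℝ) (θ : ℕ) (Y : ℤ → Vec p) (t : ℤ) : Vec p :=
  prox C lam (sampleMean θ Y t)

/-- Differencing: the statistic `S[t]`; it depends on `Y[t - θ + 1], …, Y[t + θ]` only, so that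
for `θ ≤ t ≤ n - θ` it is a function of the observations `Y[1], …, Y[n]`. -/
def diffStat {p : ℕ} (C : Set (Vec p)) (lam : ℝ) (θ : ℕ) (Y : ℤ → Vec p) (t : ℤ) : ℝ :=
  ‖denoised C lam θ Y (t + 1) - denoised C lam θ Y (t - θ + 1)‖

/-- The indices at which `S` is defined and which are farther than `θ` from every change-point. -/
def farPoints {p : ℕ} (n θ : ℕ) (X : ℤ → Vec p) : Set ℤ :=
  {i | (θ : ℤ) ≤ i ∧ i ≤ n - θ ∧ ∀ j ∈ changePoints n X, (θ : ℤ) < |i - j|}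

/-- The pairs of a change-point `t` and a shift `δ` outside the buffer zone and within `θ`, such
that `S` is defined at `t + δ`. The radius `(4 r √(log n) / η + 4) (σ η / Δ) √θ` of the buffer
zone is written with the factor `η` multiplied out. -/
def bufferPairs {p : ℕ} (C : Set (Vec p)) (n θ : ℕ) (X : ℤ → Vec p) (σ r Δ : ℝ) : Set (ℤ × ℤ) :=
  {q | q.1 ∈ changePoints n X ∧ |q.2| ≤ (θ : ℤ) ∧
    (4 * r * √(Real.log n) + 4 * eta C n X) * σ / Δ * √(θ : ℝ) < |(q.2 : ℝ)| ∧
    (θ : ℤ) ≤ q.1 + q.2 ∧ q.1 + q.2 ≤ n - θ}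

/-- The observations `Y[t] = X[t] + ε[t]`. -/
def obs {p : ℕ} {Ω : Type*} (X : ℤ → Vec p) (ε : ℤ → Ω → Vec p) (ω : Ω) (t : ℤ) : Vec p :=
  X t + ε t ω

/-- `S[t] ≥ γ` at all change-points. -/
def event1 {p : ℕ} {Ω : Type*} (C : Set (Vec p)) (n θ : ℕ) (X : ℤ → Vec p)
    (ε : ℤ → Ω → Vec p) (lam γ : ℝ) : Set Ω :=
  {ω | ∀ t ∈ changePoints n X, γ ≤ diffStat C lam θ (obs X ε ω) t}

/-- `S[t] < γ` at all points far from the change-points. -/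
def event2 {p : ℕ} {Ω : Type*} (C : Set (Vec p)) (n θ : ℕ) (X : ℤ → Vec p)
    (ε : ℤ → Ω → Vec p) (lam γ : ℝ) : Set Ω :=
  {ω | ∀ t ∈ farPoints n θ X, diffStat C lam θ (obs X ε ω) t < γ}

/-- `S[t] > S[t + δ]` for all change-points `t` and shifts `δ` outside the buffer zone. -/
def event3 {p : ℕ} {Ω : Type*} (C : Set (Vec p)) (n θ : ℕ) (X : ℤ → Vec p)
    (ε : ℤ → Ω → Vec p) (lam σ r Δ : ℝ) : Set Ω :=
  {ω | ∀ q ∈ bufferPairs C n θ X σ r Δ,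
    diffStat C lam θ (obs X ε ω) (q.1 + q.2) < diffStat C lam θ (obs X ε ω) q.1}

end ChangePoint

end

/-! All three failure events lie in one bad event of probability at most `n ^ (1 - r ^ 2)`.
Comparing the prox with any subgradient `v` at `x` gives `‖prox y - x‖ ≤ ‖y - x - λ v‖`, so
denoising a window costs its signal bias plus `σ/√θ` times the distance of a standard Gaussian
vector to `lam₀ • ∂‖x‖_C`. Hence `S[s]` differs from the jump `‖X[s+1] - X[s]‖` by at most the
biases of its two windows plus `σ/√θ` times a sum of two such distances (`abs_diffStat_sub_le`).

The two windows at `s` are disjoint, so the distances are independent. Each has mean at most `η`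
and, being a 1-Lipschitz function of a Gaussian vector, is sub-Gaussian around it with parameter 1.
The sum therefore reaches `β = 2 (η + r √(log n))` with probability at most `n ^ (-r ^ 2)`; a union
bound over at most `n` indices gives the bad event. Gaussian concentration with this sharp constant
(`hasSubgaussianMGF_of_lipschitzWith_stdGaussian`) is derived from the Prékopa-Leindler inequality.

Off the bad event the rest is deterministic. Change-points are at least `4θ` apart, so both biases
vanish at change-points and far points; with `cβ ≤ γ ≤ Δ/2` and `c = σ/√θ` this settles the first
two events. At distance `|δ|` from a change-point, jump plus biases drop to at most `(1 - |δ|/θ)`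
times the jump there, and outside the buffer zone this drop exceeds the noise `2cβ`
(`deviation_near_changePoint`). -/

open scoped ENNReal NNReal

/-! ### Brunn-Minkowski and Prékopa-Leindler on the line. -/

/-- The one-dimensional Brunn-Minkowski inequality for compact sets. -/
lemma IsCompact.volume_add_volume_le {K L S : Set ℝ} (hK : IsCompact K) (hL : IsCompact L)
    (hKne : K.Nonempty) (hLne : L.Nonempty) (h : ∀ a ∈ K, ∀ b ∈ L, a + b ∈ S) :
    volume K + volume L ≤ volume S := by
  obtain ⟨k, hkK, hk⟩ := hK.exists_isGreatest hKne
  obtain ⟨l, hlL, hl⟩ := hL.exists_isLeast hLne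
  -- The translates `K + l` and `k + L` both lie in `S`; the first is to the left of `k + l` and the
  -- second to the right, so they share at most that point.
  have hKm : volume ((fun x => x + l) '' K) = volume K := by
    rw [Set.image_add_right, measure_preimage_add_right]
  have hLm : volume ((fun x => k + x) '' L) = volume L := by
    rw [Set.image_add_left, measure_preimage_add]
  have hdisj : AEDisjoint volume ((fun x => x + l) '' K) ((fun x => k + x) '' L) := by
    refine measure_mono_null (t := {k + l}) ?_ (by simp)
    rintro _ ⟨⟨x, hx, rfl⟩, y, hy, hxy⟩
    have h1 := hk hx
    have h2 := hl hy
    simp only at hxy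
    simp only [Set.mem_singleton_iff]
    linarith
  rw [← hKm, ← hLm, ← measure_union₀ (hL.image (by fun_prop)).measurableSet.nullMeasurableSet hdisj]
  refine measure_mono (Set.union_subset ?_ ?_)
  · rintro _ ⟨x, hx, rfl⟩
    exact h x hx l hlL
  · rintro _ ⟨y, hy, rfl⟩
    exact h k hkK y hy

/-- The one-dimensional Brunn-Minkowski inequality. -/
lemma MeasurableSet.volume_add_volume_le {A B S : Set ℝ} (hA : MeasurableSet A)
    (hB : MeasurableSet B) (hAne : A.Nonempty) (hBne : B.Nonempty)
    (h : ∀ a ∈ A, ∀ b ∈ B, a + b ∈ S) :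
    volume A + volume B ≤ volume S := by
  obtain ⟨a, ha⟩ := hAne
  obtain ⟨b, hb⟩ := hBne
  rw [hA.measure_eq_iSup_isCompact, hB.measure_eq_iSup_isCompact]
  simp only [iSup_and']
  refine ENNReal.biSup_add_biSup_le' ⟨∅, by simp⟩ ⟨∅, by simp⟩ ?_
  rintro K ⟨hKA, hK⟩ L ⟨hLB, hL⟩
  -- Inner approximation may return the empty set; inserting `a` and `b` keeps the compact sets
  -- nonempty.
  calc volume K + volume L ≤ volume (insert a K) + volume (insert b L) := by
        gcongr <;> exact Set.subset_insert _ _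
    _ ≤ volume S := (hK.insert a).volume_add_volume_le (hL.insert b) ⟨a, by simp⟩ ⟨b, by simp⟩
        fun x hx y hy => h x (Set.insert_subset ha hKA hx) y (Set.insert_subset hb hLB hy)

lemma lintegral_eq_lintegral_volume_lt {f : ℝ → ℝ≥0∞} (hf : Measurable f) (hf' : ∀ x, f x ≠ ∞) :
    ∫⁻ x, f x = ∫⁻ s in Set.Ioi (0 : ℝ), volume {x | ENNReal.ofReal s < f x} := by
  have h := lintegral_eq_lintegral_meas_lt volume (f := fun x => (f x).toReal)
    (.of_forall fun x => ENNReal.toReal_nonneg) hf.ennreal_toReal.aemeasurable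
  simp_rw [ENNReal.ofReal_toReal (hf' _)] at h
  rw [h]
  refine setLIntegral_congr_fun measurableSet_Ioi fun s hs => ?_
  simp_rw [ENNReal.ofReal_lt_iff_lt_toReal (le_of_lt hs) (hf' _)]

lemma volume_smul_set {t : ℝ} (ht : 0 < t) (A : Set ℝ) :
    volume (t • A) = ENNReal.ofReal t * volume A := by
  rw [Measure.addHaar_smul]
  simp [abs_of_pos ht]

/-- The additive form of the Prékopa-Leindler inequality for functions with supremum `1`. -/
lemma lintegral_add_lintegral_le_of_iSup_eq_one {u v h : ℝ → ℝ≥0∞} (hu : Measurable u)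
    (hv : Measurable v) (hh : Measurable h) (hu1 : ⨆ x, u x = 1) (hv1 : ⨆ x, v x = 1)
    {t : ℝ} (ht0 : 0 < t) (ht1 : t < 1)
    (H : ∀ x y, min (u x) (v y) ≤ h (t * x + (1 - t) * y)) :
    ENNReal.ofReal t * (∫⁻ x, u x) + ENNReal.ofReal (1 - t) * (∫⁻ x, v x) ≤ ∫⁻ x, h x := by
  have hule : ∀ x, u x ≤ 1 := fun x => hu1 ▸ le_iSup u x
  have hvle : ∀ x, v x ≤ 1 := fun x => hv1 ▸ le_iSup v x
  -- Brunn-Minkowski for superlevel sets needs both to be nonempty. The common supremum `1` makes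
  -- them nonempty for the same levels `s < 1`. Truncating `h` at `1` supplies the finiteness needed
  -- by the layer-cake formula.
  have key : ∀ s : ℝ, ENNReal.ofReal t * volume {x | ENNReal.ofReal s < u x}
      + ENNReal.ofReal (1 - t) * volume {x | ENNReal.ofReal s < v x}
      ≤ volume {x | ENNReal.ofReal s < min (h x) 1} := by
    intro s
    rcases lt_or_ge (ENNReal.ofReal s) 1 with hs | hs
    · rw [← volume_smul_set ht0, ← volume_smul_set (sub_pos.2 ht1)]
      refine MeasurableSet.volume_add_volume_le ?_ ?_ ?_ ?_ ?_
      · exact (measurableSet_lt measurable_const hu).const_smul₀ t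
      · exact (measurableSet_lt measurable_const hv).const_smul₀ _
      · obtain ⟨x, hx⟩ := lt_iSup_iff.1 (hu1 ▸ hs)
        exact ⟨t • x, Set.smul_mem_smul_set hx⟩
      · obtain ⟨x, hx⟩ := lt_iSup_iff.1 (hv1 ▸ hs)
        exact ⟨(1 - t) • x, Set.smul_mem_smul_set hx⟩
      · rintro _ ⟨x, hx, rfl⟩ _ ⟨y, hy, rfl⟩
        exact lt_min ((lt_min hx hy).trans_le (H x y)) hs
    · have h1 : {x | ENNReal.ofReal s < u x} = ∅ := by
        ext x; simpa using (hule x).trans hs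
      have h2 : {x | ENNReal.ofReal s < v x} = ∅ := by
        ext x; simpa using (hvle x).trans hs
      simp [h1, h2]
  calc _ = ∫⁻ s in Set.Ioi (0 : ℝ), (ENNReal.ofReal t * volume {x | ENNReal.ofReal s < u x}
      + ENNReal.ofReal (1 - t) * volume {x | ENNReal.ofReal s < v x}) := by
        have hanti : ∀ w : ℝ → ℝ≥0∞, Measurable fun s : ℝ => volume {x | ENNReal.ofReal s < w x} :=
          fun w => Antitone.measurable fun a b hab => measure_mono fun x hx =>
            (ENNReal.ofReal_le_ofReal hab).trans_lt hx
        rw [lintegral_eq_lintegral_volume_lt hu fun x => ((hule x).trans_lt (by simp)).ne,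
          lintegral_eq_lintegral_volume_lt hv fun x => ((hvle x).trans_lt (by simp)).ne,
          lintegral_add_left ((hanti u).const_mul _), lintegral_const_mul _ (hanti u),
          lintegral_const_mul _ (hanti v)]
    _ ≤ ∫⁻ s in Set.Ioi (0 : ℝ), volume {x | ENNReal.ofReal s < min (h x) 1} :=
        lintegral_mono key
    _ = ∫⁻ x, min (h x) 1 := (lintegral_eq_lintegral_volume_lt (hh.min measurable_const)
        fun x => ((min_le_right _ _).trans_lt (by simp)).ne).symm
    _ ≤ ∫⁻ x, h x := lintegral_mono fun x => min_le_left _ _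

lemma ENNReal.rpow_mul_rpow_le_add {t : ℝ} (ht0 : 0 < t) (ht1 : t < 1) (a b : ℝ≥0∞) :
    a ^ t * b ^ (1 - t) ≤ ENNReal.ofReal t * a + ENNReal.ofReal (1 - t) * b := by
  have ht1' : 0 < 1 - t := sub_pos.2 ht1
  rcases eq_or_ne a ∞ with rfl | ha
  · simp [ENNReal.mul_top, ht0]
  rcases eq_or_ne b ∞ with rfl | hb
  · simp [ENNReal.mul_top, ht1]
  lift a to NNReal using ha
  lift b to NNReal using hb
  have h := NNReal.geom_mean_le_arith_mean2_weighted t.toNNReal (1 - t).toNNReal a b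
    (by rw [← Real.toNNReal_add ht0.le ht1'.le]; simp)
  rw [Real.coe_toNNReal _ ht0.le, Real.coe_toNNReal _ ht1'.le] at h
  rw [← ENNReal.coe_rpow_of_nonneg _ ht0.le, ← ENNReal.coe_rpow_of_nonneg _ ht1'.le]
  simp only [ENNReal.ofReal]
  exact_mod_cast h

lemma ENNReal.min_le_rpow_mul_rpow {t : ℝ} (ht0 : 0 < t) (ht1 : t < 1) (a b : ℝ≥0∞) :
    min a b ≤ a ^ t * b ^ (1 - t) := by
  calc min a b = min a b ^ (t + (1 - t)) := by simp
    _ = min a b ^ t * min a b ^ (1 - t) := ENNReal.rpow_add_of_nonneg _ _ ht0.le (by linarith)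
    _ ≤ a ^ t * b ^ (1 - t) :=
      mul_le_mul' (ENNReal.rpow_le_rpow (min_le_left _ _) ht0.le)
        (ENNReal.rpow_le_rpow (min_le_right _ _) (by linarith))

/-- The Prékopa-Leindler inequality on the line for bounded functions. -/
lemma prekopa_leindler_of_iSup_ne_top {u v h : ℝ → ℝ≥0∞} (hu : Measurable u)
    (hv : Measurable v) (hh : Measurable h) (hu1 : ⨆ x, u x ≠ ∞) (hv1 : ⨆ x, v x ≠ ∞)
    {t : ℝ} (ht0 : 0 < t) (ht1 : t < 1)
    (H : ∀ x y, u x ^ t * v y ^ (1 - t) ≤ h (t * x + (1 - t) * y)) :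
    (∫⁻ x, u x) ^ t * (∫⁻ x, v x) ^ (1 - t) ≤ ∫⁻ x, h x := by
  have ht1' : 0 < 1 - t := sub_pos.2 ht1
  set a := ⨆ x, u x with ha
  set b := ⨆ x, v x with hb
  rcases eq_or_ne a 0 with ha0 | ha0
  · have : ∀ x, u x = 0 := fun x => by simpa using (le_iSup u x).trans ha0.le
    simp [this, ht0]
  rcases eq_or_ne b 0 with hb0 | hb0
  · have : ∀ x, v x = 0 := fun x => by simpa using (le_iSup v x).trans hb0.le
    simp [this, ht1']
  have hc0 : a ^ t * b ^ (1 - t) ≠ 0 := by simp [ha0, hb0, hu1, hv1]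
  have hctop : a ^ t * b ^ (1 - t) ≠ ∞ := by
    simp [ENNReal.mul_eq_top, ha0, hb0, hu1, hv1]
  have hmul : ∀ x y : ℝ≥0∞, (a⁻¹ * x) ^ t * (b⁻¹ * y) ^ (1 - t)
      = (a ^ t * b ^ (1 - t))⁻¹ * (x ^ t * y ^ (1 - t)) := by
    intro x y
    rw [ENNReal.mul_rpow_of_nonneg _ _ ht0.le, ENNReal.mul_rpow_of_nonneg _ _ ht1'.le,
      ENNReal.inv_rpow, ENNReal.inv_rpow, ENNReal.mul_inv (by simp [ha0, hu1])
      (by simp [ht0.le, hu1])]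
    ring
  -- After dividing by the suprema the additive inequality applies; AM-GM weakens it to the
  -- multiplicative one, which is homogeneous, so the normalizing factor cancels.
  have h1 := lintegral_add_lintegral_le_of_iSup_eq_one (u := fun x => a⁻¹ * u x)
    (v := fun x => b⁻¹ * v x) (h := fun x => (a ^ t * b ^ (1 - t))⁻¹ * h x)
    (hu.const_mul _) (hv.const_mul _) (hh.const_mul _)
    (by rw [← ENNReal.mul_iSup, ← ha, ENNReal.inv_mul_cancel ha0 hu1])
    (by rw [← ENNReal.mul_iSup, ← hb, ENNReal.inv_mul_cancel hb0 hv1]) ht0 ht1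
    (fun x y => (ENNReal.min_le_rpow_mul_rpow ht0 ht1 _ _).trans
      ((hmul _ _).trans_le (by gcongr; exact H x y)))
  have h2 := (ENNReal.rpow_mul_rpow_le_add ht0 ht1 _ _).trans h1
  rw [lintegral_const_mul _ hu, lintegral_const_mul _ hv, lintegral_const_mul _ hh, hmul] at h2
  rwa [ENNReal.mul_le_mul_iff_right (by simpa using hctop) (by simpa using hc0)] at h2

lemma tendsto_lintegral_min_natCast {α : Type*} [MeasurableSpace α] {μ : Measure α}
    {f : α → ℝ≥0∞} (hf : Measurable f) :
    Filter.Tendsto (fun k : ℕ => ∫⁻ x, min (f x) k ∂μ) .atTop (nhds (∫⁻ x, f x ∂μ)) := by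
  refine lintegral_tendsto_of_tendsto_of_monotone
    (fun k => (hf.min measurable_const).aemeasurable) (.of_forall fun x i j hij => ?_)
    (.of_forall fun x => ?_)
  · exact min_le_min le_rfl (by exact_mod_cast hij)
  · have := (tendsto_const_nhds (x := f x)).min ENNReal.tendsto_nat_nhds_top
    simpa using this

/-- The Prékopa-Leindler inequality on the line. -/
theorem prekopa_leindler {u v h : ℝ → ℝ≥0∞} (hu : Measurable u)
    (hv : Measurable v) (hh : Measurable h) {t : ℝ} (ht0 : 0 < t) (ht1 : t < 1)
    (H : ∀ x y, u x ^ t * v y ^ (1 - t) ≤ h (t * x + (1 - t) * y)) :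
    (∫⁻ x, u x) ^ t * (∫⁻ x, v x) ^ (1 - t) ≤ ∫⁻ x, h x := by
  have ht1' : 0 < 1 - t := sub_pos.2 ht1
  rcases eq_or_ne (∫⁻ x, u x) 0 with hu0 | hu0
  · simp [hu0, ht0]
  rcases eq_or_ne (∫⁻ x, v x) 0 with hv0 | hv0
  · simp [hv0, ht1']
  have hlim := ENNReal.Tendsto.mul
    ((ENNReal.continuous_rpow_const.tendsto _).comp (tendsto_lintegral_min_natCast hu))
    (.inl (by simp [hu0, ht0.le] : (∫⁻ x, u x) ^ t ≠ 0))
    ((ENNReal.continuous_rpow_const.tendsto _).comp (tendsto_lintegral_min_natCast hv))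
    (.inl (by simp [hv0, ht1.le] : (∫⁻ x, v x) ^ (1 - t) ≠ 0))
  refine le_of_tendsto' hlim fun k => prekopa_leindler_of_iSup_ne_top
    (hu.min measurable_const) (hv.min measurable_const) hh ?_ ?_ ht0 ht1 fun x y => ?_
  · exact ((iSup_le fun x => min_le_right _ _).trans_lt (ENNReal.natCast_lt_top k)).ne
  · exact ((iSup_le fun x => min_le_right _ _).trans_lt (ENNReal.natCast_lt_top k)).ne
  · exact (mul_le_mul' (ENNReal.rpow_le_rpow (min_le_left _ _) ht0.le)
      (ENNReal.rpow_le_rpow (min_le_left _ _) ht1'.le)).trans (H x y)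

/-! ### Prékopa-Leindler for Gaussian measures. -/

/-- The Prékopa-Leindler inequality for the standard Gaussian measure on the line. -/
lemma prekopa_leindler_gaussianReal {u v h : ℝ → ℝ≥0∞} (hu : Measurable u)
    (hv : Measurable v) (hh : Measurable h) {t : ℝ} (ht0 : 0 < t) (ht1 : t < 1)
    (H : ∀ x y, u x ^ t * v y ^ (1 - t)
      ≤ h (t * x + (1 - t) * y) * ENNReal.ofReal (Real.exp (t * (1 - t) / 2 * (x - y) ^ 2))) :
    (∫⁻ x, u x ∂gaussianReal 0 1) ^ t * (∫⁻ x, v x ∂gaussianReal 0 1) ^ (1 - t)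
      ≤ ∫⁻ x, h x ∂gaussianReal 0 1 := by
  have ht1' : 0 < 1 - t := sub_pos.2 ht1
  have hφ := measurable_gaussianPDF 0 1
  -- The quadratic penalty is exactly the log-concavity gap of the density: `t x² + (1-t) y² - (t x
  -- + (1-t) y)² = t (1-t) (x-y)²`.
  have hpdf : ∀ x y, gaussianPDF 0 1 x ^ t * gaussianPDF 0 1 y ^ (1 - t)
      * ENNReal.ofReal (Real.exp (t * (1 - t) / 2 * (x - y) ^ 2))
      = gaussianPDF 0 1 (t * x + (1 - t) * y) := by
    intro x y
    have h2 : (0 : ℝ) < (√(2 * Real.pi * (1 : ℝ≥0)))⁻¹ := by positivity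
    simp only [gaussianPDF, gaussianPDFReal]
    rw [ENNReal.ofReal_rpow_of_nonneg (by positivity) ht0.le,
      ENNReal.ofReal_rpow_of_nonneg (by positivity) ht1'.le,
      ← ENNReal.ofReal_mul (by positivity), ← ENNReal.ofReal_mul (by positivity),
      Real.mul_rpow h2.le (by positivity), Real.mul_rpow h2.le (by positivity),
      ← Real.exp_mul, ← Real.exp_mul]
    congr 1
    calc _ = ((√(2 * Real.pi * (1 : ℝ≥0)))⁻¹ ^ t * (√(2 * Real.pi * (1 : ℝ≥0)))⁻¹ ^ (1 - t)) *
        (Real.exp (-(x - 0) ^ 2 / (2 * (1 : ℝ≥0)) * t)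
          * Real.exp (-(y - 0) ^ 2 / (2 * (1 : ℝ≥0)) * (1 - t))
          * Real.exp (t * (1 - t) / 2 * (x - y) ^ 2)) := by ring
      _ = _ := by
        rw [← Real.rpow_add h2, ← Real.exp_add, ← Real.exp_add, add_sub_cancel, Real.rpow_one]
        congr 2
        push_cast
        ring
  have hint : ∀ w : ℝ → ℝ≥0∞, Measurable w →
      ∫⁻ x, w x ∂gaussianReal 0 1 = ∫⁻ x, gaussianPDF 0 1 x * w x := fun w hw => by
    rw [gaussianReal_of_var_ne_zero _ one_ne_zero, lintegral_withDensity_eq_lintegral_mul _ hφ hw]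
    rfl
  rw [hint u hu, hint v hv, hint h hh]
  refine prekopa_leindler (hφ.mul hu) (hφ.mul hv) (hφ.mul hh) ht0 ht1 fun x y => ?_
  simp only [Pi.mul_apply]
  rw [ENNReal.mul_rpow_of_nonneg _ _ ht0.le, ENNReal.mul_rpow_of_nonneg _ _ ht1'.le, ← hpdf]
  calc _ = gaussianPDF 0 1 x ^ t * gaussianPDF 0 1 y ^ (1 - t) * (u x ^ t * v y ^ (1 - t)) := by
        ring
    _ ≤ gaussianPDF 0 1 x ^ t * gaussianPDF 0 1 y ^ (1 - t) 
        * (h (t * x + (1 - t) * y) * ENNReal.ofReal (Real.exp (t * (1 - t) / 2 * (x - y) ^ 2))) := by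
        exact mul_le_mul_right (H x y) _
    _ = _ := by ring

lemma lintegral_pi_fin_succ {n : ℕ} {ν : Measure ℝ} [SigmaFinite ν] {u : (Fin (n + 1) → ℝ) → ℝ≥0∞}
    (hu : Measurable u) :
    ∫⁻ x, u x ∂Measure.pi (fun _ => ν)
      = ∫⁻ a, ∫⁻ z, u (Fin.cons a z) ∂Measure.pi (fun _ : Fin n => ν) ∂ν := by
  have hmp := (measurePreserving_piFinSuccAbove (fun _ : Fin (n + 1) => ν) 0).symm
  rw [← hmp.lintegral_comp hu, lintegral_prod (fun q => u _) (hu.comp hmp.measurable).aemeasurable]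
  simp [MeasurableEquiv.piFinSuccAbove_symm_apply, Fin.insertNthEquiv]

/-- The Prékopa-Leindler inequality for the standard Gaussian measure. -/
theorem prekopa_leindler_pi_gaussianReal {n : ℕ} {u v h : (Fin n → ℝ) → ℝ≥0∞} (hu : Measurable u)
    (hv : Measurable v) (hh : Measurable h) {t : ℝ} (ht0 : 0 < t) (ht1 : t < 1)
    (H : ∀ x y, u x ^ t * v y ^ (1 - t) ≤ h (t • x + (1 - t) • y)
      * ENNReal.ofReal (Real.exp (t * (1 - t) / 2 * ∑ i, (x i - y i) ^ 2))) :
    (∫⁻ x, u x ∂Measure.pi (fun _ => gaussianReal 0 1)) ^ t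
      * (∫⁻ x, v x ∂Measure.pi (fun _ => gaussianReal 0 1)) ^ (1 - t)
      ≤ ∫⁻ x, h x ∂Measure.pi (fun _ => gaussianReal 0 1) := by
  induction n with
  | zero => simpa [Measure.pi_of_empty _ (0 : Fin 0 → ℝ)] using H 0 0
  | succ n ih =>
    have hcons : Measurable fun q : ℝ × (Fin n → ℝ) => (Fin.cons q.1 q.2 : Fin (n + 1) → ℝ) := by
      refine measurable_pi_iff.2 fun i => ?_
      induction i using Fin.cases with
      | zero => simpa using measurable_fst
      | succ i => simpa [Function.comp_def] using (measurable_pi_apply i).comp measurable_snd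
    have hcons' : ∀ a : ℝ, Measurable fun z : Fin n → ℝ => (Fin.cons a z : Fin (n + 1) → ℝ) :=
      fun a => hcons.comp measurable_prodMk_left
    rw [lintegral_pi_fin_succ hu, lintegral_pi_fin_succ hv, lintegral_pi_fin_succ hh]
    refine prekopa_leindler_gaussianReal (hu.comp hcons).lintegral_prod_right'
      (hv.comp hcons).lintegral_prod_right' (hh.comp hcons).lintegral_prod_right' ht0 ht1
      fun a b => ?_
    -- With the first coordinates `a`, `b` frozen, their share of the penalty is a constant factor
    -- absorbed into `h`; the one-dimensional inequality then handles the integrals over the first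
    -- coordinate.
    have := ih (hu.comp (hcons' a)) (hv.comp (hcons' b))
      ((hh.comp (hcons' (t * a + (1 - t) * b))).mul_const
        (ENNReal.ofReal (Real.exp (t * (1 - t) / 2 * (a - b) ^ 2)))) fun x y => ?_
    · rwa [lintegral_mul_const _ (hh.comp (hcons' _))] at this
    · refine (H (Fin.cons a x) (Fin.cons b y)).trans_eq ?_
      have : t • (Fin.cons a x : Fin (n + 1) → ℝ) + (1 - t) • (Fin.cons b y : Fin (n + 1) → ℝ)
          = Fin.cons (t * a + (1 - t) * b) (t • x + (1 - t) • y) := by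
        ext i
        induction i using Fin.cases <;> simp
      rw [this, Fin.sum_univ_succ, mul_add, Real.exp_add, ENNReal.ofReal_mul (by positivity)]
      simp [mul_assoc]

/-! ### Gaussian concentration of Lipschitz functions. -/

/-- Jensen's inequality, from `g + 1 ≤ exp g`. With a lower integral, integrability of `exp g` need
not be assumed. -/
lemma one_le_lintegral_exp {α : Type*} [MeasurableSpace α] {ν : Measure α} [IsProbabilityMeasure ν]
    {g : α → ℝ} (hg : Integrable g ν) (hg0 : ∫ x, g x ∂ν = 0) :
    1 ≤ ∫⁻ x, ENNReal.ofReal (Real.exp (g x)) ∂ν := by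
  by_cases htop : ∫⁻ x, ENNReal.ofReal (Real.exp (g x)) ∂ν = ∞
  · simp [htop]
  have hnn : 0 ≤ᵐ[ν] fun x => Real.exp (g x) := .of_forall fun x => (Real.exp_pos _).le
  have hint : Integrable (fun x => Real.exp (g x)) ν :=
    (lintegral_ofReal_ne_top_iff_integrable
      (Real.continuous_exp.comp_aestronglyMeasurable hg.aestronglyMeasurable) hnn).1 htop
  rw [← ofReal_integral_eq_lintegral_ofReal hint hnn, ENNReal.one_le_ofReal]
  calc (1 : ℝ) = ∫ x, (g x + 1) ∂ν := by rw [integral_add hg (integrable_const _), hg0]; simp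
    _ ≤ _ := integral_mono (hg.add (integrable_const _)) hint fun x => Real.add_one_le_exp _

lemma integrable_of_lipschitzWith_stdGaussian {n : ℕ} {K : ℝ≥0}
    {f : EuclideanSpace ℝ (Fin n) → ℝ} (hf : LipschitzWith K f) :
    Integrable f (stdGaussian (EuclideanSpace ℝ (Fin n))) := by
  have hid : Integrable (fun x : EuclideanSpace ℝ (Fin n) => x)
    (stdGaussian (EuclideanSpace ℝ (Fin n))) := IsGaussian.integrable_id
  refine ((integrable_const |f 0|).add (hid.norm.const_mul (K : ℝ))).mono'
    hf.continuous.measurable.aestronglyMeasurable (.of_forall fun x => ?_)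
  have := hf.dist_le_mul x 0
  rw [Real.dist_eq, dist_zero_right] at this
  simp only [Pi.add_apply, Real.norm_eq_abs]
  linarith [abs_sub_abs_le_abs_sub (f x) (f 0)]

/-- A centered Lipschitz function of a standard Gaussian vector has a sub-Gaussian moment
generating function; first for the constant enlarged by a factor. -/
lemma lintegral_exp_le_of_lipschitzWith_stdGaussian_aux {n : ℕ} {K : ℝ≥0}
    {f : EuclideanSpace ℝ (Fin n) → ℝ} (hf : LipschitzWith K f)
    (hf0 : ∫ x, f x ∂stdGaussian (EuclideanSpace ℝ (Fin n)) = 0) {t : ℝ} (ht0 : 0 < t)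
    (ht1 : t < 1) :
    ∫⁻ x, ENNReal.ofReal (Real.exp (f x)) ∂stdGaussian (EuclideanSpace ℝ (Fin n))
      ≤ ENNReal.ofReal (Real.exp (K ^ 2 / (2 * (1 - t)))) := by
  have ht1' : 0 < 1 - t := sub_pos.2 ht1
  have hmf : Measurable f := hf.continuous.measurable
  have hmL : Measurable (WithLp.toLp 2 : (Fin n → ℝ) → EuclideanSpace ℝ (Fin n)) := by fun_prop
  have htr : ∀ w : EuclideanSpace ℝ (Fin n) → ℝ≥0∞, Measurable w →
      ∫⁻ x, w x ∂stdGaussian (EuclideanSpace ℝ (Fin n))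
        = ∫⁻ x, w (WithLp.toLp 2 x) ∂Measure.pi (fun _ => gaussianReal 0 1) := fun w hw => by
    rw [← map_pi_eq_stdGaussian, lintegral_map hw hmL]
  have hlow : 1 ≤ ∫⁻ x, ENNReal.ofReal (Real.exp (-(t / (1 - t)) * f x))
      ∂stdGaussian (EuclideanSpace ℝ (Fin n)) :=
    one_le_lintegral_exp ((integrable_of_lipschitzWith_stdGaussian hf).const_mul _)
      (by rw [integral_const_mul, hf0, mul_zero])
  have hm1 : Measurable fun x => ENNReal.ofReal (Real.exp (f x - K ^ 2 / (2 * (1 - t)))) := by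
    fun_prop
  have hm2 : Measurable fun x => ENNReal.ofReal (Real.exp (-(t / (1 - t)) * f x)) := by
    fun_prop
  -- The exponent `-t/(1-t)` makes the weighted product depend on `f x - f y` only. The Lipschitz
  -- bound and AM-GM put it below the quadratic penalty, so `h = 1` is admissible. The second
  -- integral is at least `1` by Jensen, which leaves the first at most `1`.
  have hpl := prekopa_leindler_pi_gaussianReal (h := fun _ => 1) (hm1.comp hmL) (hm2.comp hmL)
    measurable_const ht0 ht1 fun x y => ?_
  · simp only [Function.comp_apply] at hpl
    rw [← htr _ hm1, ← htr _ hm2, lintegral_one, measure_univ] at hpl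
    have h1 : ∫⁻ x, ENNReal.ofReal (Real.exp (f x - K ^ 2 / (2 * (1 - t))))
        ∂stdGaussian (EuclideanSpace ℝ (Fin n)) ≤ 1 := by
      have h2 : (∫⁻ x, ENNReal.ofReal (Real.exp (f x - K ^ 2 / (2 * (1 - t))))
          ∂stdGaussian (EuclideanSpace ℝ (Fin n))) ^ t ≤ 1 := by
        refine le_trans ?_ hpl
        conv_lhs => rw [← mul_one (_ ^ t)]
        gcongr
        exact ENNReal.one_le_rpow hlow ht1'
      rwa [← ENNReal.one_rpow t, ENNReal.rpow_le_rpow_iff ht0] at h2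
    calc _ = ∫⁻ x, ENNReal.ofReal (Real.exp (K ^ 2 / (2 * (1 - t))))
        * ENNReal.ofReal (Real.exp (f x - K ^ 2 / (2 * (1 - t))))
        ∂stdGaussian (EuclideanSpace ℝ (Fin n)) := by
          refine lintegral_congr fun x => ?_
          rw [← ENNReal.ofReal_mul (by positivity), ← Real.exp_add]
          ring_nf
      _ = _ := lintegral_const_mul _ hm1
      _ ≤ _ := mul_le_of_le_one_right' h1
  · simp only [Function.comp_apply]
    rw [ENNReal.ofReal_rpow_of_pos (by positivity), ENNReal.ofReal_rpow_of_pos (by positivity),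
      ← Real.exp_mul, ← Real.exp_mul, ← ENNReal.ofReal_mul (by positivity), ← Real.exp_add, one_mul]
    refine ENNReal.ofReal_le_ofReal (Real.exp_le_exp.2 ?_)
    set X := WithLp.toLp 2 x
    set Y := WithLp.toLp 2 y
    have hd : ∑ i, (x i - y i) ^ 2 = ‖X - Y‖ ^ 2 := by
      simp [EuclideanSpace.real_norm_sq_eq, X, Y]
    have hlip : f X - f Y ≤ K * ‖X - Y‖ := by
      have := hf.dist_le_mul X Y
      rw [Real.dist_eq, dist_eq_norm] at this
      exact (le_abs_self _).trans this
    have hamgm : K * ‖X - Y‖ - K ^ 2 / (2 * (1 - t)) ≤ (1 - t) / 2 * ‖X - Y‖ ^ 2 := by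
      have : 0 ≤ (K - (1 - t) * ‖X - Y‖) ^ 2 / (2 * (1 - t)) := by positivity
      have h' : (K - (1 - t) * ‖X - Y‖) ^ 2 / (2 * (1 - t))
          = K ^ 2 / (2 * (1 - t)) - K * ‖X - Y‖ + (1 - t) / 2 * ‖X - Y‖ ^ 2 := by
        field_simp
        ring
      linarith
    rw [hd]
    calc _ = t * (f X - f Y - K ^ 2 / (2 * (1 - t))) := by field_simp; ring
      _ ≤ t * ((1 - t) / 2 * ‖X - Y‖ ^ 2) := by gcongr; linarith
      _ = _ := by ring

lemma lintegral_exp_le_of_lipschitzWith_stdGaussian {n : ℕ} {K : ℝ≥0}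
    {f : EuclideanSpace ℝ (Fin n) → ℝ} (hf : LipschitzWith K f)
    (hf0 : ∫ x, f x ∂stdGaussian (EuclideanSpace ℝ (Fin n)) = 0) :
    ∫⁻ x, ENNReal.ofReal (Real.exp (f x)) ∂stdGaussian (EuclideanSpace ℝ (Fin n))
      ≤ ENNReal.ofReal (Real.exp (K ^ 2 / 2)) := by
  have hlim : Filter.Tendsto (fun t : ℝ => ENNReal.ofReal (Real.exp (K ^ 2 / (2 * (1 - t)))))
      (nhdsWithin 0 (Set.Ioi 0)) (nhds (ENNReal.ofReal (Real.exp (K ^ 2 / 2)))) := by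
    have : ContinuousAt (fun t : ℝ => ENNReal.ofReal (Real.exp (K ^ 2 / (2 * (1 - t))))) 0 := by
      refine ENNReal.continuous_ofReal.continuousAt.comp (Real.continuous_exp.continuousAt.comp ?_)
      exact ContinuousAt.div (by fun_prop) (by fun_prop) (by norm_num)
    have h := this.tendsto
    simp only [sub_zero, mul_one] at h
    exact h.mono_left nhdsWithin_le_nhds
  refine ge_of_tendsto hlim ?_
  -- The limit `t → 0` recovers the sharp constant `K ^ 2 / 2`.
  filter_upwards [Ioo_mem_nhdsGT (zero_lt_one (α := ℝ))] with t ht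
  exact lintegral_exp_le_of_lipschitzWith_stdGaussian_aux hf hf0 ht.1 ht.2

/-- Gaussian concentration: a centered Lipschitz function of a standard Gaussian vector is
sub-Gaussian. -/
theorem hasSubgaussianMGF_of_lipschitzWith_stdGaussian {n : ℕ} {K : ℝ≥0}
    {f : EuclideanSpace ℝ (Fin n) → ℝ} (hf : LipschitzWith K f) :
    HasSubgaussianMGF (fun x => f x - ∫ y, f y ∂stdGaussian (EuclideanSpace ℝ (Fin n))) (K ^ 2)
      (stdGaussian (EuclideanSpace ℝ (Fin n))) := by
  set m := ∫ y, f y ∂stdGaussian (EuclideanSpace ℝ (Fin n)) with hm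
  have hfi := integrable_of_lipschitzWith_stdGaussian hf
  have key : ∀ s : ℝ, ∫⁻ x, ENNReal.ofReal (Real.exp (s * (f x - m)))
      ∂stdGaussian (EuclideanSpace ℝ (Fin n)) ≤ ENNReal.ofReal (Real.exp (↑(K ^ 2) * s ^ 2 / 2)) := by
    intro s
    have hlip : LipschitzWith (‖s‖₊ * K) fun x => s * (f x - m) := by
      refine LipschitzWith.of_dist_le_mul fun x y => ?_
      have := hf.dist_le_mul x y
      rw [Real.dist_eq] at this ⊢
      rw [← mul_sub, sub_sub_sub_cancel_right, abs_mul]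
      push_cast
      rw [Real.norm_eq_abs, mul_assoc]
      gcongr
    refine (lintegral_exp_le_of_lipschitzWith_stdGaussian hlip ?_).trans_eq ?_
    · rw [integral_const_mul, integral_sub hfi (integrable_const _)]
      simp [hm]
    · push_cast
      rw [mul_pow, Real.norm_eq_abs, sq_abs]
      ring_nf
  have hmeas : ∀ s : ℝ, Measurable fun x => Real.exp (s * (f x - m)) := fun s => by
    have := hf.continuous.measurable
    fun_prop
  have hnn : ∀ s : ℝ, 0 ≤ᵐ[stdGaussian (EuclideanSpace ℝ (Fin n))]
      fun x => Real.exp (s * (f x - m)) := fun s => .of_forall fun x => (Real.exp_pos _).le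
  have hint : ∀ s : ℝ, Integrable (fun x => Real.exp (s * (f x - m)))
      (stdGaussian (EuclideanSpace ℝ (Fin n))) := fun s =>
    (lintegral_ofReal_ne_top_iff_integrable (hmeas s).aestronglyMeasurable (hnn s)).1
      ((key s).trans_lt ENNReal.ofReal_lt_top).ne
  refine ⟨hint, fun s => ?_⟩
  rw [mgf, ← ENNReal.ofReal_le_ofReal_iff (by positivity),
    ofReal_integral_eq_lintegral_ofReal (hint s) (hnn s)]
  exact key s

/-! ### The proximal operator and deterministic bounds on the statistic. -/

noncomputable section

namespace ChangePoint

variable {p : ℕ} {C : Set (Vec p)}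

/-- Hahn-Banach: the functional `a • x ↦ a * gauge C x` on the line through `x` is dominated by the
gauge and extends. Nonemptiness matters because `Metric.infDist` to the empty set is `0` by
convention. -/
lemma subdifferential_gauge_nonempty (hC : Convex ℝ C) (hC0 : (0 : Vec p) ∈ interior C)
    (x : Vec p) : (subdifferential (gauge C) x).Nonempty := by
  have habs : Absorbent ℝ C := absorbent_nhds_zero (mem_interior_iff_mem_nhds.1 hC0)
  rcases eq_or_ne x 0 with rfl | hx
  · exact ⟨0, fun y => by simpa using gauge_nonneg y⟩
  obtain ⟨g, hg, hgle⟩ := exists_extension_of_le_sublinear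
    (LinearPMap.mkSpanSingleton x (gauge C x) hx) (gauge C)
    (fun c hc z => gauge_smul_of_nonneg hc.le z) (gauge_add_le hC habs) (by
      rintro ⟨z, hz⟩
      obtain ⟨a, rfl⟩ := Submodule.mem_span_singleton.1 hz
      refine (LinearPMap.mkSpanSingleton'_apply x (gauge C x) _ a hz).trans_le ?_
      rcases le_total 0 a with ha | ha
      · simp [gauge_smul_of_nonneg ha]
      · exact (smul_nonpos_of_nonpos_of_nonneg ha (gauge_nonneg x)).trans (gauge_nonneg _))
  have hgx : g x = gauge C x := by
    have := hg ⟨x, Submodule.mem_span_singleton_self x⟩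
    rwa [LinearPMap.mkSpanSingleton_apply] at this
  refine ⟨(InnerProductSpace.toDual ℝ (Vec p)).symm g.toContinuousLinearMap, fun y => ?_⟩
  rw [InnerProductSpace.toDual_symm_apply, map_sub]
  have := hgle y
  simp only [LinearMap.coe_toContinuousLinearMap']
  linarith

/-- The choice in `prox` is meaningful only if a minimizer exists; the objective is continuous and
coercive. Uniqueness plays no role. -/
lemma isMinOn_prox (hC : Convex ℝ C) (hC0 : (0 : Vec p) ∈ interior C) {lam : ℝ} (hlam : 0 ≤ lam)
    (y : Vec p) :
    IsMinOn (fun z : Vec p => 1 / 2 * ‖y - z‖ ^ 2 + lam * gauge C z) Set.univ (prox C lam y) := by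
  refine Classical.epsilon_spec (p := fun x : Vec p =>
    IsMinOn (fun z : Vec p => 1 / 2 * ‖y - z‖ ^ 2 + lam * gauge C z) Set.univ x) ?_
  have hcont : Continuous fun z : Vec p => 1 / 2 * ‖y - z‖ ^ 2 + lam * gauge C z := by
    have := continuous_gauge hC (mem_interior_iff_mem_nhds.1 hC0)
    fun_prop
  have hlim : Filter.Tendsto (fun z : Vec p => 1 / 2 * ‖y - z‖ ^ 2 + lam * gauge C z)
      (Filter.cocompact (Vec p)) Filter.atTop := by
    have h1 : Filter.Tendsto (fun z : Vec p => 1 / 2 * ‖y - z‖ ^ 2) (Filter.cocompact (Vec p))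
        Filter.atTop := by
      refine Filter.Tendsto.const_mul_atTop (by norm_num)
        ((Filter.tendsto_pow_atTop two_ne_zero).comp ?_)
      refine Filter.tendsto_atTop_mono (fun z => ?_) (Filter.tendsto_atTop_add_const_right _ (-‖y‖)
        (tendsto_norm_cocompact_atTop (E := Vec p)))
      have := norm_sub_norm_le z y
      rw [norm_sub_rev] at this
      linarith
    exact Filter.tendsto_atTop_mono
      (fun z => le_add_of_nonneg_right (mul_nonneg hlam (gauge_nonneg z))) h1
  obtain ⟨x, hx⟩ := hcont.exists_forall_le hlim
  exact ⟨x, fun z _ => hx z⟩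

/-- The variational inequality characterizing the proximal operator. -/
lemma inner_sub_prox_le (hC : Convex ℝ C) (hC0 : (0 : Vec p) ∈ interior C) {lam : ℝ}
    (hlam : 0 ≤ lam) (y z : Vec p) :
    inner ℝ (y - prox C lam y) (z - prox C lam y)
      ≤ lam * gauge C z - lam * gauge C (prox C lam y) := by
  set x := prox C lam y with hx
  have habs : Absorbent ℝ C := absorbent_nhds_zero (mem_interior_iff_mem_nhds.1 hC0)
  -- Minimality is tested at a point of the segment from `x` to `z`, divided by `a`; the quadratic
  -- remainder vanishes as `a → 0`.
  have key : ∀ a ∈ Set.Ioo (0 : ℝ) 1, inner ℝ (y - x) (z - x) ≤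
      lam * gauge C z - lam * gauge C x + a / 2 * ‖z - x‖ ^ 2 := by
    rintro a ⟨ha0, ha1⟩
    have hmin := isMinOn_prox hC hC0 hlam y (Set.mem_univ ((1 - a) • x + a • z))
    simp only [Set.mem_ofPred_eq, ← hx] at hmin
    have hconv : gauge C ((1 - a) • x + a • z) ≤ (1 - a) * gauge C x + a * gauge C z := by
      refine (gauge_add_le hC habs _ _).trans_eq ?_
      rw [gauge_smul_of_nonneg (by linarith), gauge_smul_of_nonneg ha0.le, smul_eq_mul,
        smul_eq_mul]
    have hsq : ‖y - ((1 - a) • x + a • z)‖ ^ 2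
        = ‖y - x‖ ^ 2 - 2 * (a * inner ℝ (y - x) (z - x)) + a ^ 2 * ‖z - x‖ ^ 2 := by
      rw [show y - ((1 - a) • x + a • z) = (y - x) - a • (z - x) by module, norm_sub_sq_real,
        inner_smul_right, norm_smul, mul_pow, Real.norm_eq_abs, sq_abs]
    rw [hsq] at hmin
    have h2 := mul_le_mul_of_nonneg_left hconv hlam
    have h3 : a * inner ℝ (y - x) (z - x) ≤
        a * (lam * gauge C z - lam * gauge C x + a / 2 * ‖z - x‖ ^ 2) := by
      linarith
    exact le_of_mul_le_mul_left h3 ha0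
  have hlim : Filter.Tendsto (fun a : ℝ => lam * gauge C z - lam * gauge C x + a / 2 * ‖z - x‖ ^ 2)
      (nhdsWithin 0 (Set.Ioi 0)) (nhds (lam * gauge C z - lam * gauge C x)) := by
    have : Continuous fun a : ℝ => lam * gauge C z - lam * gauge C x + a / 2 * ‖z - x‖ ^ 2 := by
      fun_prop
    have := this.tendsto 0
    simp only [zero_div, zero_mul, add_zero] at this
    exact this.mono_left nhdsWithin_le_nhds
  refine ge_of_tendsto hlim ?_
  filter_upwards [Ioo_mem_nhdsGT (zero_lt_one (α := ℝ))] with a ha using key a ha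

/-- The error of the proximal operator is at most the distance of the noise to the scaled
subdifferential. -/
lemma norm_prox_sub_le (hC : Convex ℝ C) (hC0 : (0 : Vec p) ∈ interior C) {lam : ℝ}
    (hlam : 0 ≤ lam) (y x : Vec p) {v : Vec p} (hv : v ∈ subdifferential (gauge C) x) :
    ‖prox C lam y - x‖ ≤ ‖y - x - lam • v‖ := by
  have h1 := inner_sub_prox_le hC hC0 hlam y x
  have h2 := mul_le_mul_of_nonneg_left (hv (prox C lam y)) hlam
  set d := prox C lam y - x with hd
  have h3 : inner ℝ (y - prox C lam y) (x - prox C lam y) = -inner ℝ (y - x) d + ‖d‖ ^ 2 := by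
    rw [show x - prox C lam y = -d by simp [hd],
      show y - prox C lam y = (y - x) - d by simp [hd], inner_neg_right, inner_sub_left,
      real_inner_self_eq_norm_sq]
    ring
  -- The variational inequality and the subgradient inequality add up to `‖d‖² ≤ ⟨y - x - lam • v,
  -- d⟩`; Cauchy-Schwarz finishes.
  have h4 : ‖d‖ * ‖d‖ ≤ ‖y - x - lam • v‖ * ‖d‖ := by
    refine le_trans ?_ (real_inner_le_norm _ _)
    rw [inner_sub_left, inner_smul_left]
    simp only [conj_trivial]
    linarith
  rcases (norm_nonneg d).eq_or_lt with h0 | h0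
  · rw [← h0]; exact norm_nonneg _
  · exact le_of_mul_le_mul_right h4 h0

/-- The noise of a sample mean, scaled to have variance one. -/
def scaledNoise {Ω : Type*} (σ : ℝ) (θ : ℕ) (ε : ℤ → Ω → Vec p) (i : ℤ) (ω : Ω) : Vec p :=
  (σ * √(θ : ℝ))⁻¹ • ∑ t ∈ Finset.Icc i (i + θ - 1), ε t ω

lemma sampleMean_obs {Ω : Type*} {σ : ℝ} (hσ : 0 < σ) {θ : ℕ} (hθ : 1 ≤ θ) (X : ℤ → Vec p)
    (ε : ℤ → Ω → Vec p) (i : ℤ) (ω : Ω) :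
    sampleMean θ (obs X ε ω) i = sampleMean θ X i + (σ / √(θ : ℝ)) • scaledNoise σ θ ε i ω := by
  have hθ' : (0 : ℝ) < θ := by exact_mod_cast hθ
  have hs : σ / √(θ : ℝ) * (σ * √(θ : ℝ))⁻¹ = (θ : ℝ)⁻¹ := by
    have := Real.sqrt_pos.2 hθ'
    field_simp
    rw [Real.sq_sqrt hθ'.le]
  simp only [sampleMean, scaledNoise, obs, Finset.sum_add_distrib, smul_add, smul_smul, hs]

/-- With `λ = (σ/√θ) lam₀` the residual `y - x - λ v` is the bias plus `σ/√θ` times `g - lam₀ v`,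
and the infimum over `v` turns the latter into a distance. -/
lemma norm_denoised_sub_le {Ω : Type*} (hC : Convex ℝ C) (hC0 : (0 : Vec p) ∈ interior C)
    {σ : ℝ} (hσ : 0 < σ) {θ : ℕ} (hθ : 1 ≤ θ) {lam₀ : ℝ} (hlam : 0 ≤ lam₀) (X : ℤ → Vec p)
    (ε : ℤ → Ω → Vec p) (i : ℤ) (ω : Ω) (x : Vec p) :
    ‖denoised C (σ / √(θ : ℝ) * lam₀) θ (obs X ε ω) i - x‖ ≤ ‖sampleMean θ X i - x‖
      + σ / √(θ : ℝ) * Metric.infDist (scaledNoise σ θ ε i ω)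
        (lam₀ • subdifferential (gauge C) x) := by
  have hθ' : (0 : ℝ) < √(θ : ℝ) := Real.sqrt_pos.2 (by exact_mod_cast hθ)
  have hc : 0 < σ / √(θ : ℝ) := by positivity
  set c := σ / √(θ : ℝ) with hc_def
  set g := scaledNoise σ θ ε i ω with hg
  rw [← sub_le_iff_le_add', ← div_le_iff₀' hc,
    Metric.le_infDist ((subdifferential_gauge_nonempty hC hC0 x).smul_set)]
  rintro _ ⟨v, hv, rfl⟩
  rw [div_le_iff₀' hc, sub_le_iff_le_add', dist_eq_norm]
  refine (norm_prox_sub_le hC hC0 (by positivity) _ x hv).trans ?_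
  rw [sampleMean_obs hσ hθ, ← hg, ← hc_def,
    show sampleMean θ X i + c • g - x - (c * lam₀) • v
      = (sampleMean θ X i - x) + c • (g - lam₀ • v) by module]
  refine (norm_add_le _ _).trans_eq ?_
  rw [norm_smul, Real.norm_of_nonneg hc.le]

lemma norm_sampleMean_sub_le {θ : ℕ} (hθ : 1 ≤ θ) {X : ℤ → Vec p} {i : ℤ} {x : Vec p} {d : ℝ}
    {A : Finset ℤ} (hA : A ⊆ Finset.Icc i (i + θ - 1)) (hd : ∀ j ∈ A, ‖X j - x‖ ≤ d)
    (hx : ∀ j ∈ Finset.Icc i (i + θ - 1), j ∉ A → X j = x) :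
    ‖sampleMean θ X i - x‖ ≤ (A.card / θ : ℝ) * d := by
  have hθ' : (0 : ℝ) < θ := by exact_mod_cast hθ
  have h1 : sampleMean θ X i - x
      = (θ : ℝ)⁻¹ • ∑ j ∈ Finset.Icc i (i + θ - 1), (X j - x) := by
    rw [Finset.sum_sub_distrib, Finset.sum_const, Int.card_Icc, sampleMean, smul_sub,
      show (i + θ - 1 + 1 - i).toNat = θ by simp, ← Nat.cast_smul_eq_nsmul ℝ, smul_smul,
      inv_mul_cancel₀ hθ'.ne', one_smul]
  have h2 : ∑ j ∈ Finset.Icc i (i + θ - 1), (X j - x) = ∑ j ∈ A, (X j - x) :=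
    (Finset.sum_subset hA fun j hj hjA => by rw [hx j hj hjA, sub_self]).symm
  rw [h1, h2, norm_smul, norm_inv, Real.norm_of_nonneg hθ'.le, div_eq_inv_mul, mul_assoc]
  gcongr
  refine (norm_sum_le_of_le _ hd).trans_eq ?_
  rw [Finset.sum_const, nsmul_eq_mul]

lemma sampleMean_eq {θ : ℕ} (hθ : 1 ≤ θ) {X : ℤ → Vec p} {i : ℤ} {x : Vec p}
    (hx : ∀ j ∈ Finset.Icc i (i + θ - 1), X j = x) : sampleMean θ X i = x := by
  have := norm_sampleMean_sub_le hθ (d := 0) (Finset.empty_subset _) (by simp)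
    (fun j hj _ => hx j hj)
  simpa [sub_eq_zero] using this

lemma eq_of_forall_notMem_changePoints {n : ℕ} {X : ℤ → Vec p} {a b : ℤ} (ha : 1 ≤ a) (hb : b ≤ n)
    (hab : a ≤ b) (h : ∀ j, a ≤ j → j < b → j ∉ changePoints n X) : X b = X a := by
  induction b, hab using Int.leInduction with
  | base => rfl
  | succ k hk ih =>
    rw [← ih (by lia) fun j h1 h2 => h j h1 (by lia)]
    by_contra hne
    exact h k hk (by lia) ⟨by lia, by lia, fun h' => hne h'.symm⟩

/-- The deviation of the statistic at `s` caused by the noise, in units of the standard deviation of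
a sample mean. -/
def noiseDist {Ω : Type*} (C : Set (Vec p)) (σ lam₀ : ℝ) (θ : ℕ) (X : ℤ → Vec p)
    (ε : ℤ → Ω → Vec p) (s : ℤ) (ω : Ω) : ℝ :=
  Metric.infDist (scaledNoise σ θ ε (s + 1) ω) (lam₀ • subdifferential (gauge C) (X (s + 1)))
    + Metric.infDist (scaledNoise σ θ ε (s - θ + 1) ω) (lam₀ • subdifferential (gauge C) (X s))

/-- Each window is compared with its entry next to the split, `X (s + 1)` on the right and `X s` on
the left. -/
lemma abs_diffStat_sub_le {Ω : Type*} (hC : Convex ℝ C) (hC0 : (0 : Vec p) ∈ interior C)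
    {σ : ℝ} (hσ : 0 < σ) {θ : ℕ} (hθ : 1 ≤ θ) {lam₀ : ℝ} (hlam : 0 ≤ lam₀) (X : ℤ → Vec p)
    (ε : ℤ → Ω → Vec p) (s : ℤ) (ω : Ω) :
    |diffStat C (σ / √(θ : ℝ) * lam₀) θ (obs X ε ω) s - ‖X (s + 1) - X s‖|
      ≤ ‖sampleMean θ X (s + 1) - X (s + 1)‖ + ‖sampleMean θ X (s - θ + 1) - X s‖
        + σ / √(θ : ℝ) * noiseDist C σ lam₀ θ X ε s ω := by
  have h1 := norm_denoised_sub_le hC hC0 hσ hθ hlam X ε (s + 1) ω (X (s + 1))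
  have h2 := norm_denoised_sub_le hC hC0 hσ hθ hlam X ε (s - θ + 1) ω (X s)
  rw [diffStat, noiseDist]
  set a := denoised C (σ / √(θ : ℝ) * lam₀) θ (obs X ε ω) (s + 1)
  set b := denoised C (σ / √(θ : ℝ) * lam₀) θ (obs X ε ω) (s - θ + 1)
  have h3 : |‖a - b‖ - ‖X (s + 1) - X s‖| ≤ ‖a - X (s + 1)‖ + ‖b - X s‖ := by
    refine (abs_norm_sub_norm_le _ _).trans ?_
    rw [show a - b - (X (s + 1) - X s) = (a - X (s + 1)) - (b - X s) by abel]
    exact norm_sub_le _ _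
  linarith

end ChangePoint

end

/-! ### Law of the window noise and the union bound. -/

noncomputable section

namespace ChangePoint

variable {p : ℕ} {Ω : Type*} [MeasurableSpace Ω] {μ : Measure Ω}

/-- The window of `θ` indices from `i` on, as a set of indices in `{1, …, n}`. -/
def window (n θ : ℕ) (i : ℤ) : Finset (Set.Icc (1 : ℤ) n) :=
  (Finset.Icc i (i + θ - 1)).subtype (· ∈ Set.Icc (1 : ℤ) n)

lemma sum_window {E : Type*} [AddCommMonoid E] {n θ : ℕ} {i : ℤ} (h1 : 1 ≤ i)
    (h2 : i + θ - 1 ≤ n) (f : ℤ → E) :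
    ∑ t ∈ window n θ i, f t = ∑ t ∈ Finset.Icc i (i + θ - 1), f t := by
  refine Finset.sum_subtype_of_mem f fun t ht => ?_
  rw [Finset.mem_Icc] at ht
  exact ⟨by lia, by lia⟩

lemma charFun_multivariateGaussian_smul_one {σ : ℝ} (x : Vec p) :
    charFun (multivariateGaussian 0 (σ ^ 2 • (1 : Matrix (Fin p) (Fin p) ℝ))) x
      = Complex.exp (-(σ ^ 2 * ‖x‖ ^ 2) / 2) := by
  have hS : (σ ^ 2 • (1 : Matrix (Fin p) (Fin p) ℝ)).PosSemidef :=
    Matrix.PosSemidef.one.smul (sq_nonneg σ)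
  rw [charFun_multivariateGaussian hS]
  have : x.ofLp ⬝ᵥ (σ ^ 2 • (1 : Matrix (Fin p) (Fin p) ℝ)).mulVec x.ofLp = σ ^ 2 * ‖x‖ ^ 2 := by
    rw [Matrix.smul_mulVec, Matrix.one_mulVec, dotProduct_smul, EuclideanSpace.real_norm_sq_eq,
      smul_eq_mul]
    simp [dotProduct, sq]
  rw [this]
  congr 1
  push_cast
  simp [neg_div]

/-- Characteristic functions: `θ` equal Gaussian factors at `x / (σ√θ)` multiply to the standard one
at `x`. -/
lemma hasLaw_scaledNoise [IsProbabilityMeasure μ] {n θ : ℕ} (hθ : 1 ≤ θ) {σ : ℝ} (hσ : 0 < σ)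
    {ε : ℤ → Ω → Vec p}
    (hε : ∀ t ∈ Set.Icc (1 : ℤ) n,
      HasLaw (ε t) (multivariateGaussian 0 (σ ^ 2 • (1 : Matrix (Fin p) (Fin p) ℝ))) μ)
    (hindep : iIndepFun (fun t : Set.Icc (1 : ℤ) n => ε t) μ) {i : ℤ} (h1 : 1 ≤ i)
    (h2 : i + θ - 1 ≤ n) :
    HasLaw (scaledNoise σ θ ε i) (stdGaussian (Vec p)) μ := by
  have hm : ∀ t : Set.Icc (1 : ℤ) n, AEMeasurable (ε t) μ := fun t => (hε t t.2).aemeasurable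
  have hsum : AEMeasurable (fun ω => ∑ t ∈ window n θ i, ε t ω) μ :=
    Finset.aemeasurable_fun_sum _ fun t _ => hm t
  have heq : scaledNoise σ θ ε i = fun ω => (σ * √(θ : ℝ))⁻¹ • ∑ t ∈ window n θ i, ε t ω := by
    ext1 ω
    rw [scaledNoise, sum_window h1 h2 fun t => ε t ω]
  have hcard : (window n θ i).card = θ := by
    have := sum_window h1 h2 (fun _ => 1)
    simpa using this
  rw [heq]
  have hsmul : AEMeasurable (fun ω => (σ * √(θ : ℝ))⁻¹ • ∑ t ∈ window n θ i, ε t ω) μ :=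
    hsum.const_smul (σ * √(θ : ℝ))⁻¹
  refine ⟨hsmul, ?_⟩
  have := Measure.isProbabilityMeasure_map hsmul
  refine Measure.ext_of_charFun (funext fun x => ?_)
  rw [charFun_map_smul_comp hsum, iIndepFun.charFun_map_fun_finsetSum_eq_prod
    (X := fun t : Set.Icc (1 : ℤ) n => ε t) (fun t _ => hm t) (hindep.restrict _),
    Finset.prod_apply,
    Finset.prod_congr rfl fun t _ => by
      rw [(hε t t.2).map_eq, charFun_multivariateGaussian_smul_one],
    Finset.prod_const, hcard, ← Complex.exp_nat_mul, charFun_stdGaussian]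
  congr 1
  have hθ' : (0 : ℝ) < θ := by exact_mod_cast hθ
  have hnorm : (θ : ℝ) * (-(σ ^ 2 * ‖(σ * √(θ : ℝ))⁻¹ • x‖ ^ 2) / 2) = -‖x‖ ^ 2 / 2 := by
    rw [norm_smul, mul_pow, norm_inv, Real.norm_eq_abs, inv_pow, sq_abs, mul_pow,
      Real.sq_sqrt hθ'.le]
    field_simp
  exact_mod_cast congrArg (fun a : ℝ => (a : ℂ)) hnorm

lemma indepFun_scaledNoise [IsProbabilityMeasure μ] {n θ : ℕ} {σ : ℝ} {ε : ℤ → Ω → Vec p}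
    (hε : ∀ t ∈ Set.Icc (1 : ℤ) n, AEMeasurable (ε t) μ)
    (hindep : iIndepFun (fun t : Set.Icc (1 : ℤ) n => ε t) μ) {i j : ℤ} (hi1 : 1 ≤ i)
    (hj1 : 1 ≤ j) (hi2 : i + θ - 1 ≤ n) (hj2 : j + θ - 1 ≤ n) (hij : j + θ ≤ i) :
    IndepFun (scaledNoise σ θ ε i) (scaledNoise σ θ ε j) μ := by
  have hdisj : Disjoint (window n θ i) (window n θ j) := by
    rw [Finset.disjoint_left]
    intro t ht ht'
    simp only [window, Finset.mem_subtype, Finset.mem_Icc] at ht ht'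
    lia
  have hcomp := (hindep.indepFun_finset₀ _ _ hdisj fun t => hε t t.2).comp
    (φ := fun f => (σ * √(θ : ℝ))⁻¹ • ∑ t, f t) (ψ := fun f => (σ * √(θ : ℝ))⁻¹ • ∑ t, f t)
    (by fun_prop) (by fun_prop)
  have heq : ∀ k : ℤ, 1 ≤ k → k + θ - 1 ≤ n → scaledNoise σ θ ε k
      = (fun f => (σ * √(θ : ℝ))⁻¹ • ∑ t, f t) ∘ fun ω (t : window n θ k) => ε t ω := by
    intro k hk1 hk2
    ext1 ω
    simp only [scaledNoise, Function.comp_apply]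
    rw [← sum_window hk1 hk2 fun t => ε t ω,
      Finset.sum_coe_sort (window n θ k) fun t : Set.Icc (1 : ℤ) n => ε t ω]
  rwa [← heq i hi1 hi2, ← heq j hj1 hj2] at hcomp

/-- The distance to any set is 1-Lipschitz, whence parameter 1. -/
lemma hasSubgaussianMGF_infDist {g : Ω → Vec p} (hg : HasLaw g (stdGaussian (Vec p)) μ)
    (A : Set (Vec p)) :
    HasSubgaussianMGF
      (fun ω => Metric.infDist (g ω) A - ∫ y, Metric.infDist y A ∂stdGaussian (Vec p)) 1 μ := by
  have h := hasSubgaussianMGF_of_lipschitzWith_stdGaussian (Metric.lipschitz_infDist_pt A)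
  rw [one_pow, ← hg.map_eq] at h
  have := h.of_map hg.aemeasurable
  rwa [hg.map_eq] at this

/-- Independence adds the two sub-Gaussian parameters to 2, so a deviation `2r√(log n)` has
probability at most `exp (-4r² log n / (2 · 2)) = n ^ (-r ^ 2)`. -/
lemma measureReal_le_noiseDist [IsProbabilityMeasure μ] {n θ : ℕ} (hθ : 1 ≤ θ) {σ : ℝ}
    (hσ : 0 < σ) {X : ℤ → Vec p} {ε : ℤ → Ω → Vec p}
    (hε : ∀ t ∈ Set.Icc (1 : ℤ) n,
      HasLaw (ε t) (multivariateGaussian 0 (σ ^ 2 • (1 : Matrix (Fin p) (Fin p) ℝ))) μ)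
    (hindep : iIndepFun (fun t : Set.Icc (1 : ℤ) n => ε t) μ) {C : Set (Vec p)} {lam₀ m r : ℝ}
    (hm : ∀ t ∈ Set.Icc (1 : ℤ) n, gaussDist C lam₀ (X t) ≤ m) (hr : 0 ≤ r)
    {s : ℤ} (h1 : θ ≤ s) (h2 : s ≤ n - θ) :
    μ.real {ω | 2 * (m + r * √(Real.log n)) ≤ noiseDist C σ lam₀ θ X ε s ω}
      ≤ (n : ℝ) ^ (-r ^ 2) := by
  have hn : 1 ≤ n := by lia
  have hlog : 0 ≤ Real.log n := Real.log_nonneg (by exact_mod_cast hn)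
  have hR := hasSubgaussianMGF_infDist
    (hasLaw_scaledNoise hθ hσ hε hindep (i := s + 1) (by lia) (by lia))
    (lam₀ • subdifferential (gauge C) (X (s + 1)))
  have hL := hasSubgaussianMGF_infDist
    (hasLaw_scaledNoise hθ hσ hε hindep (i := s - θ + 1) (by lia) (by lia))
    (lam₀ • subdifferential (gauge C) (X s))
  have hind := indepFun_scaledNoise (σ := σ) (θ := θ) (fun t ht => (hε t ht).aemeasurable) hindep
    (i := s + 1) (j := s - θ + 1) (by lia) (by lia) (by lia) (by lia) (by lia)
  have hadd := hR.add_of_indepFun hL (hind.comp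
    (φ := fun g => Metric.infDist g (lam₀ • subdifferential (gauge C) (X (s + 1)))
      - ∫ y, Metric.infDist y (lam₀ • subdifferential (gauge C) (X (s + 1))) ∂stdGaussian (Vec p))
    (ψ := fun g => Metric.infDist g (lam₀ • subdifferential (gauge C) (X s))
      - ∫ y, Metric.infDist y (lam₀ • subdifferential (gauge C) (X s)) ∂stdGaussian (Vec p))
    ((Metric.continuous_infDist_pt _).measurable.sub_const _)
    ((Metric.continuous_infDist_pt _).measurable.sub_const _))
  have htail := hadd.measure_ge_le (ε := 2 * r * √(Real.log n)) (by positivity)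
  refine (measureReal_mono ?_).trans (htail.trans_eq ?_)
  · intro ω hω
    have hmR := hm (s + 1) ⟨by lia, by lia⟩
    have hmL := hm s ⟨by lia, by lia⟩
    simp only [gaussDist] at hmR hmL
    simp only [Set.mem_ofPred_eq, noiseDist] at hω ⊢
    linarith
  · rw [Real.rpow_def_of_pos (by exact_mod_cast hn)]
    congr 1
    push_cast
    rw [neg_div, mul_pow, Real.sq_sqrt hlog]
    ring

/-- With high probability, the noise moves the statistic little at all indices. -/
lemma measureReal_exists_le_noiseDist [IsProbabilityMeasure μ] {n θ : ℕ} (hθ : 1 ≤ θ) {σ : ℝ}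
    (hσ : 0 < σ) {X : ℤ → Vec p} {ε : ℤ → Ω → Vec p}
    (hε : ∀ t ∈ Set.Icc (1 : ℤ) n,
      HasLaw (ε t) (multivariateGaussian 0 (σ ^ 2 • (1 : Matrix (Fin p) (Fin p) ℝ))) μ)
    (hindep : iIndepFun (fun t : Set.Icc (1 : ℤ) n => ε t) μ) {C : Set (Vec p)} {lam₀ m r : ℝ}
    (hm : ∀ t ∈ Set.Icc (1 : ℤ) n, gaussDist C lam₀ (X t) ≤ m) (hr : 0 ≤ r) :
    μ.real {ω | ∃ s ∈ Finset.Icc (θ : ℤ) (n - θ),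
      2 * (m + r * √(Real.log n)) ≤ noiseDist C σ lam₀ θ X ε s ω} ≤ (n : ℝ) ^ (1 - r ^ 2) := by
  rcases Nat.eq_zero_or_pos n with rfl | hn
  · have : Finset.Icc (θ : ℤ) ((0 : ℕ) - θ) = ∅ := Finset.Icc_eq_empty (by lia)
    rw [this]
    simp only [Finset.notMem_empty, false_and, exists_false, Set.ofPred_false, measureReal_empty]
    positivity
  have hset : {ω | ∃ s ∈ Finset.Icc (θ : ℤ) (n - θ),
      2 * (m + r * √(Real.log n)) ≤ noiseDist C σ lam₀ θ X ε s ω}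
      = ⋃ s ∈ Finset.Icc (θ : ℤ) (n - θ),
        {ω | 2 * (m + r * √(Real.log n)) ≤ noiseDist C σ lam₀ θ X ε s ω} := by
    ext ω; simp
  rw [hset]
  refine (measureReal_biUnion_finset_le _ _).trans ((Finset.sum_le_card_nsmul _ _ _ fun s hs =>
    measureReal_le_noiseDist hθ hσ hε hindep hm hr (Finset.mem_Icc.1 hs).1
      (Finset.mem_Icc.1 hs).2).trans ?_)
  have hcard : ((Finset.Icc (θ : ℤ) (n - θ)).card : ℝ) ≤ n := by
    rw [Int.card_Icc]
    exact_mod_cast (by lia : (n - θ + 1 - θ : ℤ).toNat ≤ n)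
  have hn' : (0 : ℝ) < n := by exact_mod_cast hn
  rw [nsmul_eq_mul, sub_eq_add_neg 1, Real.rpow_add hn', Real.rpow_one]
  gcongr

end ChangePoint

end

/-! ### Geometry of windows around change-points. -/

namespace ChangePoint

variable {p : ℕ} {C : Set (Vec p)} {n θ : ℕ} {X : ℤ → Vec p}

lemma gaussDist_nonneg (lam : ℝ) (x : Vec p) : 0 ≤ gaussDist C lam x :=
  integral_nonneg fun _ => Metric.infDist_nonneg

lemma eta_nonneg : 0 ≤ eta C n X :=
  Real.iInf_nonneg fun _ => Real.iSup_nonneg fun _ => gaussDist_nonneg _ _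

/-- The index set is finite, so the real supremum is a genuine upper bound, and `lam₀` attains the
infimum. -/
lemma gaussDist_le_eta {lam₀ : ℝ}
    (hmin : IsMinOn (maxGaussDist C n X) (Set.Ici 0) lam₀) {t : ℤ} (ht : t ∈ Set.Icc (1 : ℤ) n) :
    gaussDist C lam₀ (X t) ≤ eta C n X := by
  have : Nonempty (Set.Ici (0 : ℝ)) := ⟨⟨0, Set.self_mem_Ici⟩⟩
  exact (le_ciSup (f := fun t : Set.Icc (1 : ℤ) n => gaussDist C lam₀ (X t))
    (Set.finite_range _).bddAbove ⟨t, ht⟩).trans (le_ciInf fun lam => hmin lam.2)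

/-- A change-point `j` separates `j` from `j + 1`, so for the window `s + 1, …, s + θ` only `s + 1 ≤
j < s + θ` matter: `s` itself may be a change-point. -/
lemma sampleMean_right_eq (hθ : 1 ≤ θ) {s : ℤ} (h1 : 0 ≤ s) (h2 : s ≤ n - θ)
    (h : ∀ j, s + 1 ≤ j → j < s + θ → j ∉ changePoints n X) :
    sampleMean θ X (s + 1) = X (s + 1) := by
  refine sampleMean_eq hθ fun j hj => ?_
  rw [Finset.mem_Icc] at hj
  exact eq_of_forall_notMem_changePoints (n := n) (by lia) (by lia) (by lia)
    fun k hk1 hk2 => h k hk1 (by lia)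

lemma sampleMean_left_eq (hθ : 1 ≤ θ) {s : ℤ} (h1 : θ ≤ s) (h2 : s ≤ n)
    (h : ∀ j, s - θ + 1 ≤ j → j < s → j ∉ changePoints n X) :
    sampleMean θ X (s - θ + 1) = X s := by
  refine sampleMean_eq hθ fun j hj => ?_
  rw [Finset.mem_Icc] at hj
  exact (eq_of_forall_notMem_changePoints (n := n) (by lia) (by lia) (by lia)
    fun k hk1 hk2 => h k (by lia) hk2).symm

lemma notMem_changePoints_of_abs_sub_lt {T : ℝ} (hT : IsMinimum (spacings n X) T)
    (hθT : (θ : ℝ) ≤ T / 4) {t j : ℤ} (ht : t ∈ changePoints n X) (hne : j ≠ t)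
    (hlt : |j - t| < 4 * θ) : j ∉ changePoints n X := by
  intro hj
  have hmem : |(j : ℝ) - t| ∈ spacings n X := ⟨j, hj, t, ht, hne, rfl⟩
  have h1 := (hT ⟨_, hmem⟩).2 hmem
  have h2 : |(j : ℝ) - t| < 4 * θ := by exact_mod_cast hlt
  linarith

/-- Deviation of the two window means from the signal at a point close to a change-point, together
with the size of the jump at that point. -/
lemma deviation_near_changePoint (hθ : 1 ≤ θ) {t δ : ℤ}
    (hiso : ∀ j, j ≠ t → |j - t| < 4 * θ → j ∉ changePoints n X)
    (hδ : |δ| ≤ θ) (hδ0 : δ ≠ 0) (h1 : θ ≤ t + δ) (h2 : t + δ ≤ n - θ) :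
    ‖X (t + δ + 1) - X (t + δ)‖ + ‖sampleMean θ X (t + δ + 1) - X (t + δ + 1)‖
      + ‖sampleMean θ X (t + δ - θ + 1) - X (t + δ)‖
      ≤ (1 - |(δ : ℝ)| / θ) * ‖X (t + 1) - X t‖ := by
  have hθ' : (0 : ℝ) < θ := by exact_mod_cast hθ
  -- The windows at `t + δ` stay within `2θ` of `t`, where `t` is the only possible change-point.
  have hafter : ∀ j, t + 1 ≤ j → j ≤ t + 3 * θ → 1 ≤ t + 1 → j ≤ n → X j = X (t + 1) :=
    fun j hj1 hj2 ht hjn => eq_of_forall_notMem_changePoints ht hjn hj1 fun k hk1 hk2 =>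
      hiso k (by lia) (by rw [abs_lt]; constructor <;> lia)
  have hbefore : ∀ j, t - 3 * θ ≤ j → j ≤ t → 1 ≤ j → t ≤ n → X j = X t :=
    fun j hj1 hj2 hj ht => (eq_of_forall_notMem_changePoints hj ht hj2 fun k hk1 hk2 =>
      hiso k (by lia) (by rw [abs_lt]; constructor <;> lia)).symm
  rcases lt_or_gt_of_ne hδ0 with hneg | hpos
  -- For `δ < 0` the left window precedes the change and there is no jump at `t + δ`; only the `θ -
  -- |δ|` right-window entries beyond `t` are off, each by the full jump. The case `δ > 0` mirrors
  -- this.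
  · rw [abs_of_neg hneg] at hδ
    have hX1 : X (t + δ + 1) = X t := hbefore _ (by lia) (by lia) (by lia) (by lia)
    have hX2 : X (t + δ) = X t := hbefore _ (by lia) (by lia) (by lia) (by lia)
    have hL : sampleMean θ X (t + δ - θ + 1) = X (t + δ) :=
      sampleMean_left_eq hθ h1 (by lia) fun j hj1 hj2 =>
        hiso j (by lia) (by rw [abs_lt]; constructor <;> lia)
    have hR := norm_sampleMean_sub_le hθ (X := X) (i := t + δ + 1) (x := X t)
      (d := ‖X (t + 1) - X t‖) (A := Finset.Icc (t + 1) (t + δ + θ))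
      (Finset.Icc_subset_Icc (by lia) (by lia))
      (fun j hj => by
        rw [Finset.mem_Icc] at hj
        rw [hafter j hj.1 (by lia) (by lia) (by lia)])
      (fun j hj hjA => by
        rw [Finset.mem_Icc] at hj hjA
        exact hbefore j (by lia) (by lia) (by lia) (by lia))
    have hcard : ((Finset.Icc (t + 1) (t + δ + θ)).card : ℝ) = θ + δ := by
      rw [Int.card_Icc]
      have : ((t + δ + θ + 1 - (t + 1)).toNat : ℤ) = θ + δ := by lia
      exact_mod_cast this
    rw [hcard] at hR
    rw [hL, hX1, hX2, sub_self, norm_zero, zero_add, add_zero]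
    refine hR.trans_eq ?_
    rw [abs_of_neg (by exact_mod_cast hneg)]
    field_simp
    ring
  · rw [abs_of_pos hpos] at hδ
    have hX1 : X (t + δ + 1) = X (t + 1) := hafter _ (by lia) (by lia) (by lia) (by lia)
    have hX2 : X (t + δ) = X (t + 1) := hafter _ (by lia) (by lia) (by lia) (by lia)
    have hR : sampleMean θ X (t + δ + 1) = X (t + δ + 1) :=
      sampleMean_right_eq hθ (by lia) h2 fun j hj1 hj2 =>
        hiso j (by lia) (by rw [abs_lt]; constructor <;> lia)
    have hL := norm_sampleMean_sub_le hθ (X := X) (i := t + δ - θ + 1) (x := X (t + 1))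
      (d := ‖X (t + 1) - X t‖) (A := Finset.Icc (t + δ - θ + 1) t)
      (Finset.Icc_subset_Icc (by lia) (by lia))
      (fun j hj => by
        rw [Finset.mem_Icc] at hj
        rw [hbefore j (by lia) (by lia) (by lia) (by lia), norm_sub_rev])
      (fun j hj hjA => by
        rw [Finset.mem_Icc] at hj hjA
        exact hafter j (by lia) (by lia) (by lia) (by lia))
    have hcard : ((Finset.Icc (t + δ - θ + 1) t).card : ℝ) = θ - δ := by
      rw [Int.card_Icc]
      have : ((t + 1 - (t + δ - θ + 1)).toNat : ℤ) = θ - δ := by lia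
      exact_mod_cast this
    rw [hcard] at hL
    rw [hR, hX1, hX2, sub_self, norm_zero, zero_add, zero_add]
    refine hL.trans_eq ?_
    rw [abs_of_pos (by exact_mod_cast hpos)]
    field_simp

end ChangePoint

/-! ### The three events. -/

open ChangePoint in
theorem proposition1
    {Ω : Type*} [MeasurableSpace Ω] (μ : Measure Ω) [IsProbabilityMeasure μ]
    (p n : ℕ) (σ : ℝ) (hσ : 0 < σ)
    -- the signal and the noise; only the indices 1, …, n matter
    (X : ℤ → ChangePoint.Vec p) (ε : ℤ → Ω → ChangePoint.Vec p)
    (hε : ∀ t ∈ Set.Icc (1 : ℤ) n,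
      HasLaw (ε t) (multivariateGaussian 0 (σ ^ 2 • (1 : Matrix (Fin p) (Fin p) ℝ))) μ)
    (hindep : iIndepFun (fun t : Set.Icc (1 : ℤ) n => ε t) μ)
    -- the smallest change and the smallest spacing
    (Δ T : ℝ)
    (hΔ : ChangePoint.IsMinimum (ChangePoint.jumpSizes n X) Δ)
    (hT : ChangePoint.IsMinimum (ChangePoint.spacings n X) T)
    (C : Set (ChangePoint.Vec p)) (hC : Convex ℝ C) (hC0 : (0 : ChangePoint.Vec p) ∈ interior C)
    (r : ℝ) (hr : 1 < r)
    (hsuff : 64 * σ ^ 2 * (ChangePoint.eta C n X + r * √(2 * Real.log n)) ^ 2 ≤ Δ ^ 2 * T)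
    (hτ : ∀ t ∈ ChangePoint.changePoints n X, T / 4 ≤ (t : ℝ) ∧ (t : ℝ) ≤ n - T / 4)
    -- the parameters of the algorithm
    (θ : ℕ) (hθ : 1 ≤ θ) (hθT : (θ : ℝ) ≤ T / 4)
    (γ : ℝ) (hγ : γ ≤ Δ / 2)
    (hγ' : 2 * (σ / √(θ : ℝ)) * (ChangePoint.eta C n X + r * √(2 * Real.log n)) ≤ γ)
    (lam₀ lam : ℝ) (hlam₀ : 0 ≤ lam₀)
    (hmin : IsMinOn (ChangePoint.maxGaussDist C n X) (Set.Ici 0) lam₀)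
    (hlam : lam = σ / √(θ : ℝ) * lam₀) :
    μ.real (ChangePoint.event1 C n θ X ε lam γ)ᶜ ≤ 2 * (n : ℝ) ^ (1 - r ^ 2) ∧
    μ.real (ChangePoint.event2 C n θ X ε lam γ)ᶜ ≤ 2 * (n : ℝ) ^ (1 - r ^ 2) ∧
    μ.real (ChangePoint.event3 C n θ X ε lam σ r Δ)ᶜ ≤ (n : ℝ) ^ (1 - r ^ 2) := by
  subst hlam
  set η := eta C n X with hη
  have hη0 : 0 ≤ η := eta_nonneg
  have hθ0 : (0 : ℝ) < θ := by exact_mod_cast hθ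
  have hsq : 0 < √(θ : ℝ) := Real.sqrt_pos.2 hθ0
  set c := σ / √(θ : ℝ) with hc
  have hc0 : 0 < c := by positivity
  set β := 2 * (η + r * √(Real.log n)) with hβ
  have hcβ : c * β ≤ γ := by
    refine le_trans ?_ hγ'
    have hlog : √(Real.log n) ≤ √(2 * Real.log n) :=
      Real.sqrt_le_sqrt (by linarith [Real.log_natCast_nonneg n])
    calc c * β = 2 * c * (η + r * √(Real.log n)) := by rw [hβ]; ring
      _ ≤ _ := by gcongr
  -- The single bad event used for all three bounds.
  have hbad := measureReal_exists_le_noiseDist (μ := μ) hθ hσ hε hindep (C := C) (lam₀ := lam₀)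
    (m := η) (r := r) (X := X) (fun t ht => gaussDist_le_eta hmin ht) (by linarith)
  rw [← hβ] at hbad
  -- Once a change-point exists, `Δ` is attained at an actual change and hence positive.
  have hjump : ∀ t ∈ changePoints n X, 0 < Δ ∧ Δ ≤ ‖X (t + 1) - X t‖ := by
    intro t ht
    have hmem : ‖X (t + 1) - X t‖ ∈ jumpSizes n X := ⟨t, ht, norm_sub_rev _ _⟩
    have hleast := hΔ ⟨_, hmem⟩
    obtain ⟨u, hu, hΔu⟩ := hleast.1
    exact ⟨hΔu ▸ norm_pos_iff.2 (sub_ne_zero.2 hu.2.2), hleast.2 hmem⟩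
  have hrange : ∀ t ∈ changePoints n X, (θ : ℤ) ≤ t ∧ t ≤ n - θ := by
    intro t ht
    obtain ⟨h1, h2⟩ := hτ t ht
    have h3 : (θ : ℝ) ≤ t := by linarith
    have h4 : (t : ℝ) ≤ n - θ := by linarith
    exact ⟨by exact_mod_cast h3, by exact_mod_cast h4⟩
  have hiso : ∀ t ∈ changePoints n X, ∀ j, j ≠ t → |j - t| < 4 * θ → j ∉ changePoints n X :=
    fun t ht j hne hlt => notMem_changePoints_of_abs_sub_lt hT hθT ht hne hlt
  have hpos : (0 : ℝ) ≤ (n : ℝ) ^ (1 - r ^ 2) := by positivity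
  have hstat : ∀ ω, ω ∉ {ω | ∃ s ∈ Finset.Icc (θ : ℤ) (n - θ),
      β ≤ noiseDist C σ lam₀ θ X ε s ω} → ∀ s : ℤ, θ ≤ s → s ≤ n - θ →
      |diffStat C (c * lam₀) θ (obs X ε ω) s - ‖X (s + 1) - X s‖|
        < ‖sampleMean θ X (s + 1) - X (s + 1)‖ + ‖sampleMean θ X (s - θ + 1) - X s‖ + c * β := by
    intro ω hω s hs1 hs2
    refine (abs_diffStat_sub_le hC hC0 hσ hθ hlam₀ X ε s ω).trans_lt ?_
    have : noiseDist C σ lam₀ θ X ε s ω < β := by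
      by_contra hle
      exact hω ⟨s, Finset.mem_Icc.2 ⟨hs1, hs2⟩, not_lt.1 hle⟩
    gcongr
  have hstat_cp : ∀ ω, ω ∉ {ω | ∃ s ∈ Finset.Icc (θ : ℤ) (n - θ),
      β ≤ noiseDist C σ lam₀ θ X ε s ω} → ∀ t ∈ changePoints n X,
      |diffStat C (c * lam₀) θ (obs X ε ω) t - ‖X (t + 1) - X t‖| < c * β := by
    intro ω hω t ht
    obtain ⟨h1, h2⟩ := hrange t ht
    have h := hstat ω hω t h1 h2
    rwa [sampleMean_right_eq hθ (by lia) h2 fun j hj1 hj2 => hiso t ht j (by lia)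
        (by rw [abs_lt]; constructor <;> lia),
      sampleMean_left_eq hθ h1 (by lia) fun j hj1 hj2 => hiso t ht j (by lia)
        (by rw [abs_lt]; constructor <;> lia), sub_self, sub_self, norm_zero, add_zero,
      zero_add] at h
  refine ⟨?_, ?_, ?_⟩
  · refine (measureReal_mono (Set.compl_subset_comm.1 ?_)).trans (hbad.trans (by linarith))
    intro ω hω t ht
    have h := (abs_lt.1 (hstat_cp ω hω t ht)).1
    -- `S[t] > Δ - cβ ≥ Δ - γ ≥ γ`, since `cβ ≤ γ ≤ Δ / 2`.
    linarith [(hjump t ht).2]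
  · refine (measureReal_mono (Set.compl_subset_comm.1 ?_)).trans (hbad.trans (by linarith))
    rintro ω hω t ⟨h1, h2, hfar⟩
    have hfree : ∀ j, t - θ ≤ j → j ≤ t + θ → j ∉ changePoints n X := fun j hj1 hj2 hj => by
      have := hfar j hj
      rw [lt_abs] at this
      lia
    have h := hstat ω hω t h1 h2
    rw [sampleMean_right_eq hθ (by lia) h2 fun j hj1 hj2 => hfree j (by lia) (by lia),
      sampleMean_left_eq hθ h1 (by lia) fun j hj1 hj2 => hfree j (by lia) (by lia),
      eq_of_forall_notMem_changePoints (n := n) (a := t) (b := t + 1) (by lia) (by lia) (by lia)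
        fun j hj1 hj2 => hfree j (by lia) (by lia), sub_self, norm_zero] at h
    linarith [(abs_lt.1 h).2]
  · refine (measureReal_mono (Set.compl_subset_comm.1 ?_)).trans hbad
    rintro ω hω ⟨t, δ⟩ ⟨ht, hδ, hbuf, h1, h2⟩
    simp only at ht hδ hbuf h1 h2 ⊢
    obtain ⟨hΔ0, hΔt⟩ := hjump t ht
    -- The buffer radius equals `2cβθ/Δ`: beyond it the loss `|δ|/θ` of the jump outweighs the noise
    -- at both `t` and `t + δ`.
    have hbuf' : 2 * (c * β) < |(δ : ℝ)| / θ * ‖X (t + 1) - X t‖ := by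
      have hlt : 2 * (c * β) < |(δ : ℝ)| / θ * Δ := by
        have h3 : (4 * r * √(Real.log n) + 4 * η) * σ / Δ * √(θ : ℝ) = 2 * (c * β) / Δ * θ := by
          have hsqθ : c * θ = σ * √(θ : ℝ) := by
            rw [hc, div_mul_eq_mul_div, div_eq_iff hsq.ne', mul_assoc, Real.mul_self_sqrt hθ0.le]
          calc _ = 2 * β / Δ * (σ * √(θ : ℝ)) := by rw [hβ]; ring
            _ = _ := by rw [← hsqθ]; ring
        rw [h3] at hbuf
        rw [div_mul_eq_mul_div |(δ : ℝ)|, lt_div_iff₀ hθ0, ← div_lt_iff₀ hΔ0]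
        refine lt_of_eq_of_lt ?_ hbuf
        ring
      exact hlt.trans_le (by gcongr)
    have hδ0 : δ ≠ 0 := by
      rintro rfl
      have : 0 ≤ 2 * (c * β) := by positivity
      simp at hbuf'
      linarith
    have hdev := deviation_near_changePoint hθ (hiso t ht) hδ hδ0 h1 h2
    have hs := (abs_lt.1 (hstat ω hω (t + δ) h1 h2)).2
    have ht' := (abs_lt.1 (hstat_cp ω hω t ht)).1
    linarith
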